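/- Let $\mathbb F$ be a field, $d\ge 0$ an integer, and $V$ a vector space over $\mathbb F$ of dimension $d+1$. A square matrix is *irreducible tridiagonal* if its nonzero entries all lie on the diagonal, subdiagonal or superdiagonal and every entry on the subdiagonal and superdiagonal is nonzero. A matrix $Y$ (rows and columns indexed by $0,\dots,d$) *represents* $X\in\mathrm{End}(V)$ with respect to a basis $\{u_i\}_{i=0}^d$ if $Xu_j=\sum_i Y_{i,j}u_i$ for all $j$. A *Leonard pair* on $V$ is an ordered pair $A,A^*\in\mathrm{End}(V)$ such that (i) some basis of $V$ makes $A$ irreducible tridiagonal and $A^*$ diagonal, and (ii) some basis of $V$ makes $A^*$ irreducible tridiagonal and $A$ diagonal. Then $A$ and $A^*$ are multiplicity-free (diagonalizable with one-dimensional eigenspaces). The *primitive idempotent* for an eigenvalue is the projection onto its eigenspace that vanishes on the other eigenspaces. An ordering $\{E_i\}_{i=0}^d$ of the primitive idempotents of $A$ is *standard* if a basis $\{u_i\}_{i=0}^d$ with $0\ne u_i\in E_iV$ satisfies the requirement in (ii); standard orderings $\{E^*_i\}_{i=0}^d$ of the primitive idempotents of $A^*$ are defined in the same way using (i). A *Leonard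 system* on $V$ is a sequence $\Phi=(A;\{E_i\}_{i=0}^d;A^*;\{E^*_i\}_{i=0}^d)$ in which $A,A^*$ is a Leonard pair on $V$, and $\{E_i\}$, $\{E_i^*\}$ are standard orderings of the primitive idempotents of $A$, $A^*$ respectively. It is *self-dual* if some $\mathbb F$-algebra automorphism $\sigma$ of $\mathrm{End}(V)$ satisfies $\sigma(A)=A^*$, $\sigma(A^*)=A$, $\sigma(E_i)=E_i^*$ and $\sigma(E_i^*)=E_i$ for $0\le i\le d$. Let $\Phi$ be a Leonard system on $V$. Let $\theta_i$ (resp. $\theta^*_i$) be the eigenvalue of $A$ (resp. $A^*$) corresponding to $E_i$ (resp. $E^*_i$). For $0\le i\le d$ put $$\tau_i=\prod_{k=0}^{i-1}(x-\theta_k),\quad \eta_i=\prod_{k=d-i+1}^{d}(x-\theta_k),\quad \tau^*_i=\prod_{k=0}^{i-1}(x-\theta^*_k),\quad \eta^*_i=\prod_{k=d-i+1}^{d}(x-\theta^*_k).$$ For $0\ne v\in E^*_0V$ the vectors $\{\tau_i(A)v\}_{i=0}^d$ form a basis of $V$, and the matrix representing $A^*$ with respect to it is upper bidiagonal, with a superdiagonal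 $(\varphi_1,\dots,\varphi_d)$ that does not depend on $v$; $\{\varphi_i\}_{i=1}^d$ is the *first split sequence* of $\Phi$. The *second split sequence* $\{\phi_i\}_{i=1}^d$ of $\Phi$ is the first split sequence of the Leonard system $(A;\{E_{d-i}\}_{i=0}^d;A^*;\{E^*_i\}_{i=0}^d)$. Define $$T=\sum_{i=0}^d \eta_{d-i}(A)\,E^*_0E_d\,\tau^*_i(A^*)\in\mathrm{End}(V).$$ **Theorem.** Assume that $\Phi$ is self-dual, and let $v_0\in E_0V$, $v_d\in E_dV$, $v^*_0\in E^*_0V$, $v^*_d\in E^*_dV$ be nonzero. Then each of the four sequences $$\{\eta^*_i(A^*)v_0\}_{i=0}^d,\qquad \{\eta_i(A)v^*_0\}_{i=0}^d,\qquad \{\tau^*_i(A^*)v_d\}_{i=0}^d,\qquad \{\tau_i(A)v^*_d\}_{i=0}^d$$ is a basis of $V$, and with respect to each of them the matrix representing $T$ is $$\frac{\varphi_1\cdots\varphi_d}{\tau_d(\theta_d)\,\eta_d(\theta_0)}\,M,$$ where $M$ has $(d-i,i)$-entry $\phi_1\phi_2\cdots\phi_i$ for $0\le i\le d$ (equal to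 $1$ for $i=0$) and all other entries $0$. -/

import Mathlib

open Polynomial

namespace Leonard

variable {F V : Type*} [Field F] [AddCommGroup V] [Module F V] {d : ℕ}

/-- A square matrix is irreducible tridiagonal when every nonzero entry lies on the diagonal, the
subdiagonal or the superdiagonal, and all entries on the sub- and superdiagonal are nonzero. -/
def IsIrreducibleTridiagonal (M : Matrix (Fin (d + 1)) (Fin (d + 1)) F) : Prop :=
  (∀ i j, i.val + 1 < j.val ∨ j.val + 1 < i.val → M i j = 0) ∧
    ∀ i j, i.val + 1 = j.val ∨ j.val + 1 = i.val → M i j ≠ 0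

/-- A Leonard pair on `V`. The bases occurring here force `V` to be of finite positive
dimension. -/
def IsLeonardPair (A Astar : Module.End F V) : Prop :=
  (∃ (d : ℕ) (b : Module.Basis (Fin (d + 1)) F V),
    IsIrreducibleTridiagonal (LinearMap.toMatrix b b A) ∧
      (LinearMap.toMatrix b b Astar).IsDiag) ∧
  (∃ (d : ℕ) (b : Module.Basis (Fin (d + 1)) F V),
    IsIrreducibleTridiagonal (LinearMap.toMatrix b b Astar) ∧
      (LinearMap.toMatrix b b A).IsDiag)

/-- Multiplicity-free: `V` is spanned by the eigenspaces, and each of them has dimension one. -/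
def IsMultiplicityFree (A : Module.End F V) : Prop :=
  (⨆ μ, A.eigenspace μ) = ⊤ ∧ ∀ μ, A.HasEigenvalue μ → Module.finrank F (A.eigenspace μ) = 1

/-- `A` is multiplicity-free, `θ` is an ordering of its (pairwise distinct) eigenvalues, and for
every `i` the map `E i` is the projection onto the eigenspace for `θ i` that vanishes on the other
eigenspaces, i.e. the primitive idempotent of `A` for `θ i`. -/
structure IsPrimitiveIdempotents (A : Module.End F V) (E : Fin (d + 1) → Module.End F V)
    (θ : Fin (d + 1) → F) : Prop where
  multiplicityFree : IsMultiplicityFree A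
  injective : Function.Injective θ
  hasEigenvalue_iff : ∀ μ, A.HasEigenvalue μ ↔ ∃ i, θ i = μ
  apply_self : ∀ i, ∀ v ∈ A.eigenspace (θ i), E i v = v
  apply_other : ∀ i j, j ≠ i → ∀ v ∈ A.eigenspace (θ j), E i v = 0

/-- The ordering `E` of the primitive idempotents of `A` is standard: on a basis consisting of
vectors `b i ∈ E i V`, the matrix of `Astar` is irreducible tridiagonal and that of `A` is
diagonal. (Another choice of the `b i` rescales them and does not affect this.) -/
def IsStandard (A Astar : Module.End F V) (E : Fin (d + 1) → Module.End F V) : Prop :=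
  ∃ b : Module.Basis (Fin (d + 1)) F V, (∀ i, b i ∈ LinearMap.range (E i)) ∧
    IsIrreducibleTridiagonal (LinearMap.toMatrix b b Astar) ∧ (LinearMap.toMatrix b b A).IsDiag

end Leonard

/-- A Leonard system `(A; {E_i}; A^*; {E^*_i})` on `V`, with `0 ≤ i ≤ d`. -/
structure LeonardSystem (F V : Type*) [Field F] [AddCommGroup V] [Module F V] (d : ℕ) where
  A : Module.End F V
  E : Fin (d + 1) → Module.End F V
  Astar : Module.End F V
  Estar : Fin (d + 1) → Module.End F V
  isLeonardPair : Leonard.IsLeonardPair A Astar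
  primitive : ∃ θ, Leonard.IsPrimitiveIdempotents A E θ
  standard : Leonard.IsStandard A Astar E
  primitive_star : ∃ θ, Leonard.IsPrimitiveIdempotents Astar Estar θ
  standard_star : Leonard.IsStandard Astar A Estar

namespace Leonard

variable {F V : Type*} [Field F] [AddCommGroup V] [Module F V] {d : ℕ}

/-- `τ_i = (x - θ_0)(x - θ_1) ⋯ (x - θ_{i-1})`. -/
noncomputable def tau (θ : Fin (d + 1) → F) (i : Fin (d + 1)) : F[X] :=
  ∏ k : Fin (d + 1) with k < i, (X - C (θ k))

/-- `η_i = (x - θ_d)(x - θ_{d-1}) ⋯ (x - θ_{d-i+1})`; here `i.rev` is `d - i`. -/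
noncomputable def eta (θ : Fin (d + 1) → F) (i : Fin (d + 1)) : F[X] :=
  ∏ k : Fin (d + 1) with i.rev < k, (X - C (θ k))

theorem IsPrimitiveIdempotents.apply_mem {A : Module.End F V} {E : Fin (d + 1) → Module.End F V}
    {θ : Fin (d + 1) → F} (h : IsPrimitiveIdempotents A E θ) (i : Fin (d + 1)) (x : V) :
    E i x ∈ A.eigenspace (θ i) := by
  have hx : x ∈ ⨆ μ, A.eigenspace μ := by rw [h.multiplicityFree.1]; trivial
  induction hx using Submodule.iSup_induction' with
  | mem μ x hx =>
    by_cases h0 : x = 0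
    · subst h0; simp
    · obtain ⟨j, rfl⟩ := (h.hasEigenvalue_iff μ).1
        (Module.End.hasEigenvalue_of_hasEigenvector ⟨hx, h0⟩)
      by_cases hj : j = i
      · subst hj; rw [h.apply_self _ _ hx]; exact hx
      · rw [h.apply_other i j hj x hx]; exact Submodule.zero_mem _
  | zero => simp
  | add x y _ _ hx hy => rw [map_add]; exact Submodule.add_mem _ hx hy

theorem IsPrimitiveIdempotents.exists_smul {A : Module.End F V}
    {E : Fin (d + 1) → Module.End F V} {θ : Fin (d + 1) → F} (h : IsPrimitiveIdempotents A E θ)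
    (i : Fin (d + 1)) {v w : V} (hv : v ∈ LinearMap.range (E i)) (hv0 : v ≠ 0)
    (hw : w ∈ LinearMap.range (E i)) : ∃ c : F, c • v = w := by
  obtain ⟨x, rfl⟩ := hv
  obtain ⟨y, rfl⟩ := hw
  have h1 := h.multiplicityFree.2 (θ i) ((h.hasEigenvalue_iff _).2 ⟨i, rfl⟩)
  obtain ⟨c, hc⟩ := (finrank_eq_one_iff_of_nonzero' (⟨E i x, h.apply_mem i x⟩ : A.eigenspace (θ i))
    (fun h0 => hv0 (congrArg Subtype.val h0))).1 h1 ⟨E i y, h.apply_mem i y⟩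
  exact ⟨c, congrArg Subtype.val hc⟩

theorem IsPrimitiveIdempotents.rev {A : Module.End F V} {E : Fin (d + 1) → Module.End F V}
    {θ : Fin (d + 1) → F} (h : IsPrimitiveIdempotents A E θ) :
    IsPrimitiveIdempotents A (fun i => E i.rev) (fun i => θ i.rev) where
  multiplicityFree := h.multiplicityFree
  injective := h.injective.comp Fin.rev_injective
  hasEigenvalue_iff μ := (h.hasEigenvalue_iff μ).trans
    ⟨fun ⟨i, hi⟩ => ⟨i.rev, by simpa using hi⟩, fun ⟨i, hi⟩ => ⟨i.rev, hi⟩⟩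
  apply_self i := h.apply_self i.rev
  apply_other i j hij := h.apply_other i.rev j.rev (fun h' => hij (Fin.rev_injective h'))

theorem IsStandard.rev {A Astar : Module.End F V} {E : Fin (d + 1) → Module.End F V}
    (h : IsStandard A Astar E) : IsStandard A Astar (fun i => E i.rev) := by
  obtain ⟨b, hb, ht, hd⟩ := h
  have key : ∀ (X : Module.End F V) (i j : Fin (d + 1)),
      LinearMap.toMatrix (b.reindex Fin.revPerm) (b.reindex Fin.revPerm) X i j =
        LinearMap.toMatrix b b X i.rev j.rev := by
    intro X i j
    simp [LinearMap.toMatrix_apply]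
  refine ⟨b.reindex Fin.revPerm, fun i => by simpa using hb i.rev, ⟨?_, ?_⟩, ?_⟩
  · intro i j hij
    rw [key]
    apply ht.1
    simp only [Fin.val_rev]
    omega
  · intro i j hij
    rw [key]
    apply ht.2
    simp only [Fin.val_rev]
    omega
  · intro i j hij
    rw [key]
    exact hd (fun h' => hij (Fin.rev_injective h'))

theorem tau_succ (θ : Fin (d + 1) → F) (n : ℕ) (hn : n + 1 < d + 1) :
    tau θ ⟨n + 1, hn⟩ = (X - C (θ ⟨n, by omega⟩)) * tau θ ⟨n, by omega⟩ := by
  have h : (Finset.univ.filter fun k : Fin (d + 1) => k < ⟨n + 1, hn⟩) =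
      insert ⟨n, by omega⟩ (Finset.univ.filter fun k : Fin (d + 1) => k < ⟨n, by omega⟩) := by
    ext k
    simp only [Finset.mem_filter, Finset.mem_univ, true_and, Finset.mem_insert, Fin.lt_def,
      Fin.ext_iff]
    omega
  unfold tau
  rw [h, Finset.prod_insert (by simp)]

end Leonard

namespace LeonardSystem

open Leonard

variable {F V : Type*} [Field F] [AddCommGroup V] [Module F V] {d : ℕ}

/-- `Φ^* = (A^*; {E^*_i}; A; {E_i})`. -/
def dual (Φ : LeonardSystem F V d) : LeonardSystem F V d where
  A := Φ.Astar
  E := Φ.Estar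
  Astar := Φ.A
  Estar := Φ.E
  isLeonardPair := ⟨Φ.isLeonardPair.2, Φ.isLeonardPair.1⟩
  primitive := Φ.primitive_star
  standard := Φ.standard_star
  primitive_star := Φ.primitive
  standard_star := Φ.standard

/-- `Φ^⇓ = (A; {E_{d-i}}; A^*; {E^*_i})`. -/
def Down (Φ : LeonardSystem F V d) : LeonardSystem F V d where
  A := Φ.A
  E := fun i => Φ.E i.rev
  Astar := Φ.Astar
  Estar := Φ.Estar
  isLeonardPair := Φ.isLeonardPair
  primitive := Φ.primitive.imp' (fun θ i => θ i.rev) fun _ h => h.rev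
  standard := Φ.standard.rev
  primitive_star := Φ.primitive_star
  standard_star := Φ.standard_star

/-- The algebra isomorphism `σ` is an isomorphism of Leonard systems from `Φ` to `Φ'`. -/
def IsIsomorphism {V' : Type*} [AddCommGroup V'] [Module F V'] (Φ : LeonardSystem F V d)
    (Φ' : LeonardSystem F V' d) (σ : Module.End F V ≃ₐ[F] Module.End F V') : Prop :=
  σ Φ.A = Φ'.A ∧ (∀ i, σ (Φ.E i) = Φ'.E i) ∧
    σ Φ.Astar = Φ'.Astar ∧ ∀ i, σ (Φ.Estar i) = Φ'.Estar i

/-- `Φ` is self-dual when it is isomorphic to `Φ^*`. -/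
def IsSelfDual (Φ : LeonardSystem F V d) : Prop :=
  ∃ σ : Module.End F V ≃ₐ[F] Module.End F V, Φ.IsIsomorphism Φ.dual σ

/-- The eigenvalue sequence: `Φ.th i` is the eigenvalue of `A` corresponding to `E i`. -/
noncomputable def th (Φ : LeonardSystem F V d) : Fin (d + 1) → F := Φ.primitive.choose

/-- The dual eigenvalue sequence: `Φ.thstar i` is the eigenvalue of `A^*` corresponding to
`E^*_i`. -/
noncomputable def thstar (Φ : LeonardSystem F V d) : Fin (d + 1) → F := Φ.primitive_star.choose

theorem th_spec (Φ : LeonardSystem F V d) : IsPrimitiveIdempotents Φ.A Φ.E Φ.th :=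
  Φ.primitive.choose_spec

theorem thstar_spec (Φ : LeonardSystem F V d) :
    IsPrimitiveIdempotents Φ.Astar Φ.Estar Φ.thstar :=
  Φ.primitive_star.choose_spec

theorem isBasis_split (Φ : LeonardSystem F V d) {v : V}
    (hv : v ∈ LinearMap.range (Φ.Estar 0)) (hv0 : v ≠ 0) :
    LinearIndependent F (fun i => aeval Φ.A (tau Φ.th i) v) ∧
      Submodule.span F (Set.range fun i => aeval Φ.A (tau Φ.th i) v) = ⊤ := by
  obtain ⟨b, hb, ht, -⟩ := Φ.standard_star
  obtain ⟨c, hc⟩ := Φ.thstar_spec.exists_smul 0 (hb 0) (b.ne_zero 0) hv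
  have hc0 : c ≠ 0 := by rintro rfl; exact hv0 (by simpa using hc.symm)
  have main : ∀ (n : ℕ) (hn : n < d + 1),
      b.repr (aeval Φ.A (tau Φ.th ⟨n, hn⟩) v) ⟨n, hn⟩ ≠ 0 ∧
        ∀ j : Fin (d + 1), n < j.val → b.repr (aeval Φ.A (tau Φ.th ⟨n, hn⟩) v) j = 0 := by
    intro n
    induction n with
    | zero =>
      intro hn
      have h1 : tau Φ.th ⟨0, hn⟩ = 1 := by
        unfold tau
        apply Finset.prod_eq_one
        intro k hk
        simp at hk
      have h2 : (⟨0, hn⟩ : Fin (d + 1)) = 0 := rfl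
      rw [h1, ← hc, h2]
      refine ⟨by simpa using hc0, fun j hj => ?_⟩
      have : (0 : Fin (d + 1)) ≠ j := by rintro rfl; simp at hj
      simp [this]
    | succ n ih =>
      intro hn
      obtain ⟨ih1, ih2⟩ := ih (by omega)
      set u := aeval Φ.A (tau Φ.th ⟨n, by omega⟩) v with hu
      have h1 : aeval Φ.A (tau Φ.th ⟨n + 1, hn⟩) v = Φ.A u - Φ.th ⟨n, by omega⟩ • u := by
        rw [tau_succ, map_mul, Module.End.mul_apply, ← hu]
        simp [Module.algebraMap_end_apply]
      have h2 : ∀ k, b.repr (Φ.A u) k =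
          ∑ j, LinearMap.toMatrix b b Φ.A k j * b.repr u j := by
        intro k
        rw [← LinearMap.toMatrix_mulVec_repr b b Φ.A u]
        rfl
      rw [h1]
      constructor
      · rw [map_sub, Finsupp.sub_apply, map_smul, Finsupp.smul_apply, ih2 ⟨n + 1, hn⟩ (by simp),
          smul_zero, sub_zero, h2, Finset.sum_eq_single ⟨n, by omega⟩]
        · exact mul_ne_zero (ht.2 _ _ (by simp)) ih1
        · intro j _ hj
          rcases lt_or_gt_of_ne (fun h => hj (Fin.ext h) : j.val ≠ n) with h | h
          · rw [ht.1 _ _ (by simp only; omega), zero_mul]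
          · rw [ih2 j h, mul_zero]
        · simp
      · intro k hk
        rw [map_sub, Finsupp.sub_apply, map_smul, Finsupp.smul_apply, ih2 k (by omega),
          smul_zero, sub_zero, h2]
        apply Finset.sum_eq_zero
        intro j _
        rcases lt_or_ge n j.val with h | h
        · rw [ih2 j h, mul_zero]
        · rw [ht.1 _ _ (by omega), zero_mul]
  rw [b.is_basis_iff_det, Module.Basis.det_apply, Matrix.det_of_isUpperTriangular, isUnit_iff_ne_zero]
  · exact Finset.prod_ne_zero_iff.2 fun i _ => (main i.val i.isLt).1
  · intro i j hij
    exact (main j.val j.isLt).2 i hij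

/-- The `Φ`-split basis `{τ_i(A) v}` attached to a nonzero `v ∈ E^*_0 V`. -/
noncomputable def splitBasis (Φ : LeonardSystem F V d) (v : V)
    (hv : v ∈ LinearMap.range (Φ.Estar 0)) (hv0 : v ≠ 0) : Module.Basis (Fin (d + 1)) F V :=
  Module.Basis.mk (Φ.isBasis_split hv hv0).1 (Φ.isBasis_split hv hv0).2.ge

theorem exists_ne_zero (Φ : LeonardSystem F V d) :
    ∃ v : V, v ∈ LinearMap.range (Φ.Estar 0) ∧ v ≠ 0 := by
  obtain ⟨b, hb, -⟩ := Φ.standard_star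
  exact ⟨b 0, hb 0, b.ne_zero 0⟩

/-- The first split sequence of `Φ`, with `Φ.firstSplit i` for `i : Fin d` standing for
`\varphi_{i+1}`: the superdiagonal of the matrix representing `A^*` with respect to a `Φ`-split
basis. -/
noncomputable def firstSplit (Φ : LeonardSystem F V d) (i : Fin d) : F :=
  let u := Φ.splitBasis Φ.exists_ne_zero.choose Φ.exists_ne_zero.choose_spec.1
    Φ.exists_ne_zero.choose_spec.2
  LinearMap.toMatrix u u Φ.Astar i.castSucc i.succ

/-- The first split sequence does not depend on the choice of the split basis. -/
theorem firstSplit_eq (Φ : LeonardSystem F V d) (v : V)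
    (hv : v ∈ LinearMap.range (Φ.Estar 0)) (hv0 : v ≠ 0) (i : Fin d) :
    Φ.firstSplit i = LinearMap.toMatrix (Φ.splitBasis v hv hv0) (Φ.splitBasis v hv hv0)
      Φ.Astar i.castSucc i.succ := by
  have aux : ∀ (w : V) (hw : w ∈ LinearMap.range (Φ.Estar 0)) (hw0 : w ≠ 0),
      LinearMap.toMatrix (Φ.splitBasis w hw hw0) (Φ.splitBasis w hw hw0)
        Φ.Astar i.castSucc i.succ = LinearMap.toMatrix (Φ.splitBasis v hv hv0)
        (Φ.splitBasis v hv hv0) Φ.Astar i.castSucc i.succ := by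
    intro w hw hw0
    obtain ⟨c, rfl⟩ := Φ.thstar_spec.exists_smul 0 hv hv0 hw
    have hc0 : c ≠ 0 := by rintro rfl; exact hw0 (by simp)
    have hB : Φ.splitBasis (c • v) hw hw0 =
        (Φ.splitBasis v hv hv0).isUnitSMul (fun _ => IsUnit.mk0 c hc0) := by
      ext j
      simp [splitBasis, Module.Basis.isUnitSMul_apply]
    rw [hB, LinearMap.toMatrix_apply, LinearMap.toMatrix_apply,
      Module.Basis.repr_isUnitSMul, Module.Basis.isUnitSMul_apply]
    simp [Units.smul_def, hc0]
  exact aux _ _ _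

/-- The second split sequence of `Φ`, with `Φ.secondSplit i` for `i : Fin d` standing for
`\phi_{i+1}`: the first split sequence of `Φ^⇓`. -/
noncomputable def secondSplit (Φ : LeonardSystem F V d) : Fin d → F := Φ.Down.firstSplit

/-- `T = ∑_{i=0}^d η_{d-i}(A) E^*_0 E_d τ^*_i(A^*)`. -/
noncomputable def T (Φ : LeonardSystem F V d) : Module.End F V :=
  ∑ i : Fin (d + 1), aeval Φ.A (eta Φ.th i.rev) * Φ.Estar 0 * Φ.E (Fin.last d) *
    aeval Φ.Astar (tau Φ.thstar i)

/-- The matrix whose `(d - i, i)` entry is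
`\varphi_1 ⋯ \varphi_d / (τ_d(θ_d) η_d(θ_0)) * (\phi_1 ⋯ \phi_i)` for `0 ≤ i ≤ d`, all other
entries being zero. -/
noncomputable def antidiagonalMatrix (Φ : LeonardSystem F V d) :
    Matrix (Fin (d + 1)) (Fin (d + 1)) F :=
  ((∏ k : Fin d, Φ.firstSplit k) /
      ((tau Φ.th (Fin.last d)).eval (Φ.th (Fin.last d)) *
        (eta Φ.th (Fin.last d)).eval (Φ.th 0))) •
    Matrix.of fun r i => if r = i.rev then ∏ k : Fin d with k.val < i.val, Φ.secondSplit k else 0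

end LeonardSystem

/-! ### Products of linear factors evaluated at an operator. -/

namespace Leonard

variable {F V : Type*} [Field F] [AddCommGroup V] [Module F V] {d : ℕ}

/-! Write κ for `splitScalar`, ϕ_i for the second split sequence, and y_i = η_i(A)v with 0 ≠ v ∈
E^*_0 V. On the y_i, which form the split basis of `Φ.Down`, A is lower bidiagonal with subdiagonal
1, and A^* is upper bidiagonal with superdiagonal ϕ. Since E_d A = θ_d E_d, the map E_d kills every
y_n with n > 0, and by induction E_d τ^*_i(A^*) y_j = δ_ij ϕ_1⋯ϕ_i E_d v
(`IsSplitChain.apply_aeval_nodal`). So a single term of T y_j survives, and E^*_0 E_d v = κ v gives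
T y_j = κ ϕ_1⋯ϕ_j y_{d-j} (`T_splitVector_Down`). Of self-duality this uses only θ^* = θ.

By Skolem-Noether, self-duality is conjugation by an invertible S on V that exchanges A with A^* and
E_i with E^*_i. Then S v lies on the line E_0 V spanned by y_d, so S y_j = η_j(A^*) S v = c
ϕ_d⋯ϕ_{d-j+1} y_{d-j}. Comparing A^* before S with A after S shows that ϕ is a palindrome, hence T =
(κ/c) S is itself a duality (`IsSelfDual.exists_T_eq`).

For v_d ∈ E_d V it follows that T v_d ∈ E^*_d V is a multiple of τ^*_d(A^*) v_d, and E_d T = κ E_d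
τ^*_d(A^*) identifies the factor as κ. Therefore T τ^*_j(A^*) v_d = κ τ_j(A) τ^*_d(A^*) v_d, which
descends the split basis of `Φ.Down.dual`. The coefficients met there are again the ϕ_i: dual
systems share their first split sequence, by an invariant bilinear form
(`extendZero_firstSplit_dual`), and the palindrome undoes the reversal.

The other two bases are the images under T, up to a scalar, of the two already treated. As T
commutes with itself, its matrix is unchanged. -/

/-- The monic polynomial of degree `n` whose roots are `α 0, …, α (n - 1)`. -/
noncomputable def nodal (α : ℕ → F) (n : ℕ) : F[X] :=
  ∏ k ∈ Finset.range n, (X - C (α k))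

@[simp]
theorem nodal_zero (α : ℕ → F) : nodal α 0 = 1 := by simp [nodal]

theorem nodal_succ (α : ℕ → F) (n : ℕ) : nodal α (n + 1) = nodal α n * (X - C (α n)) := by
  simp [nodal, Finset.prod_range_succ]

theorem nodal_congr {α β : ℕ → F} {n : ℕ} (h : ∀ k < n, α k = β k) : nodal α n = nodal β n :=
  Finset.prod_congr rfl fun k hk => by rw [h k (Finset.mem_range.1 hk)]

theorem aeval_nodal_succ (A : Module.End F V) (α : ℕ → F) (n : ℕ) (x : V) :
    aeval A (nodal α (n + 1)) x =
      A (aeval A (nodal α n) x) - α n • aeval A (nodal α n) x := by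
  rw [nodal_succ, mul_comm, map_mul, Module.End.mul_apply]
  simp [Module.algebraMap_end_apply]

theorem aeval_nodal_succ' (A : Module.End F V) (α : ℕ → F) (n : ℕ) (x : V) :
    aeval A (nodal α (n + 1)) x = aeval A (nodal α n) (A x - α n • x) := by
  rw [nodal_succ, map_mul, Module.End.mul_apply]
  simp [Module.algebraMap_end_apply]

/-- An operator intertwining `A` and `B` intertwines `p(A)` and `p(B)`. -/
theorem apply_aeval {W : Type*} [AddCommGroup W] [Module F W] {A : Module.End F V}
    {B : Module.End F W} (f : V →ₗ[F] W) (h : ∀ x, f (A x) = B (f x)) (p : F[X]) (x : V) :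
    f (aeval A p x) = aeval B p (f x) := by
  induction p using Polynomial.induction_on generalizing x with
  | C a => simp [Module.algebraMap_end_apply]
  | add p q hp hq => simp [hp, hq]
  | monomial n a ih =>
    rw [pow_succ, ← mul_assoc, map_mul (aeval A) _ X, map_mul (aeval B) _ X, Module.End.mul_apply,
      Module.End.mul_apply, aeval_X, aeval_X, ih, h]

/-- If `f ∘ A = μ f` then `f ∘ p(A) = p(μ) f`. -/
theorem apply_aeval_of_smul {W : Type*} [AddCommGroup W] [Module F W] {A : Module.End F V}
    {μ : F} (f : V →ₗ[F] W) (h : ∀ x, f (A x) = μ • f x) (p : F[X]) (x : V) :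
    f (aeval A p x) = p.eval μ • f x := by
  rw [apply_aeval (B := algebraMap F _ μ) f (by simpa [Module.algebraMap_end_apply] using h),
    aeval_algebraMap_apply]
  simp [Module.algebraMap_end_apply]

/-! ### Pairs of operators that are bidiagonal on a sequence of vectors. -/

/-- On the sequence `y`, the operator `A` is lower bidiagonal with subdiagonal `1`, and `B` is upper
bidiagonal with superdiagonal `φ`. -/
structure IsSplitChain (A B : Module.End F V) (α β φ : ℕ → F) (y : ℕ → V) : Prop where
  raise : ∀ n, A (y n) = α n • y n + y (n + 1)
  lower_zero : B (y 0) = β 0 • y 0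
  lower : ∀ n, B (y (n + 1)) = β (n + 1) • y (n + 1) + φ n • y n

namespace IsSplitChain

variable {A B : Module.End F V} {α β φ : ℕ → F} {y : ℕ → V}

/-- Applying f to y_{n+1} = (A - α_n) y_n multiplies f(y_n) by α_0 - α_n. This factor vanishes at n
= 0, and zero persists from there on. -/
theorem apply_succ_eq_zero (h : IsSplitChain A B α β φ y) {W : Type*} [AddCommGroup W] [Module F W]
    (f : V →ₗ[F] W) (hf : ∀ x, f (A x) = α 0 • f x) (n : ℕ) : f (y (n + 1)) = 0 := by
  have key : ∀ n, f (y (n + 1)) = α 0 • f (y n) - α n • f (y n) := by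
    intro n
    rw [← hf, h.raise, map_add, map_smul]
    abel
  induction n with
  | zero => rw [key]; simp
  | succ n ih => rw [key, ih]; simp

/-- The pairing of a `α 0`-eigenfunctional of `A` with the chain and the polynomials in `B`. -/
theorem apply_aeval_nodal (h : IsSplitChain A B α β φ y) {W : Type*} [AddCommGroup W] [Module F W]
    (f : V →ₗ[F] W) (hf : ∀ x, f (A x) = α 0 • f x) (i j : ℕ) :
    f (aeval B (nodal β i) (y j)) =
      if i = j then (∏ k ∈ Finset.range i, φ k) • f (y 0) else 0 := by
  induction i generalizing j with
  | zero =>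
    cases j with
    | zero => simp
    | succ j => simp [h.apply_succ_eq_zero f hf]
  | succ i ih =>
    -- The factor B - β_i is applied to y_j first, giving (β_j - β_i) y_j plus a multiple of
    -- y_{j-1}. By induction the first term pairs to zero: either its scalar vanishes or i ≠ j.
    rw [aeval_nodal_succ']
    cases j with
    | zero =>
      rw [h.lower_zero, ← sub_smul, map_smul, map_smul, ih]
      by_cases h1 : i = 0
      · subst h1; simp
      · simp [h1]
    | succ j =>
      have : B (y (j + 1)) - β i • y (j + 1) = (β (j + 1) - β i) • y (j + 1) + φ j • y j := by
        rw [h.lower, sub_smul]; abel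
      rw [this, map_add, map_add, map_smul, map_smul, map_smul, map_smul, ih, ih]
      by_cases h1 : i = j
      · subst h1
        simp [Finset.prod_range_succ, smul_smul, mul_comm]
      · by_cases h2 : i = j + 1
        · subst h2; simp
        · simp [h1, h2]

/-- Going down the chain from `y m` with the factors of `B`. -/
theorem aeval_nodal_rev (h : IsSplitChain A B α β φ y) {m i : ℕ} (hi : i ≤ m) :
    aeval B (nodal (fun k => β (m - k)) i) (y m) =
      (∏ k ∈ Finset.range i, φ (m - 1 - k)) • y (m - i) := by
  induction i with
  | zero => simp
  | succ i ih =>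
    obtain ⟨n, hn⟩ : ∃ n, m - i = n + 1 := ⟨m - i - 1, by omega⟩
    rw [aeval_nodal_succ, ih (by omega), hn, map_smul, h.lower, smul_add, smul_comm _ (β (n + 1)),
      add_sub_cancel_left, smul_smul, Finset.prod_range_succ, show m - (i + 1) = n by omega,
      show m - 1 - i = n by omega]

end IsSplitChain

/-! ### Padding of finite sequences, and coordinates in triangular bases. -/

/-- A sequence indexed by `0, …, d` as a function on `ℕ`, constant from `d` on. -/
def extend {X : Type*} (f : Fin (d + 1) → X) (k : ℕ) : X := f ⟨min k d, by omega⟩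

theorem extend_val {X : Type*} (f : Fin (d + 1) → X) (i : Fin (d + 1)) : extend f i = f i := by
  unfold extend
  congr
  omega

theorem extend_rev {X : Type*} (f : Fin (d + 1) → X) (k : ℕ) :
    extend (fun i => f i.rev) k = extend f (d - k) := by
  unfold extend
  refine congrArg f (Fin.ext ?_)
  simp only [Fin.val_rev]
  omega

/-- A sequence indexed by `0, …, d - 1` as a function on `ℕ`, zero from `d` on. -/
def extendZero (f : Fin d → F) (k : ℕ) : F := if h : k < d then f ⟨k, h⟩ else 0

theorem tau_eq_nodal (θ : Fin (d + 1) → F) (i : Fin (d + 1)) : tau θ i = nodal (extend θ) i := by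
  obtain ⟨n, hn⟩ := i
  induction n with
  | zero =>
    rw [nodal_zero]
    exact Finset.prod_eq_one fun k hk => by simp at hk
  | succ n ih =>
    rw [tau_succ, ih, nodal_succ, mul_comm, ← extend_val θ ⟨n, by omega⟩]

theorem eta_eq_tau (θ : Fin (d + 1) → F) (i : Fin (d + 1)) :
    eta θ i = tau (fun k => θ k.rev) i := by
  unfold eta tau
  refine Finset.prod_equiv Fin.revPerm (fun k => ?_) (fun k _ => by simp)
  simp only [Finset.mem_filter, Finset.mem_univ, true_and, Fin.revPerm_apply, Fin.lt_def,
    Fin.val_rev]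
  omega

theorem eta_eq_nodal (θ : Fin (d + 1) → F) (i : Fin (d + 1)) :
    eta θ i = nodal (fun k => extend θ (d - k)) i := by
  rw [eta_eq_tau, tau_eq_nodal]
  simp only [funext (extend_rev θ)]

/-- The coordinates with respect to `b` are triangular in terms of those with respect to `w`
when the vectors of `w` are triangular in `b`. -/
theorem repr_eq_zero_of_triangular {ι : Type*} [LinearOrder ι] [Fintype ι]
    (b w : Module.Basis ι F V) (h : ∀ i j, i < j → b.repr (w i) j = 0) {x : V} {i : ι}
    (hx : ∀ j, i ≤ j → b.repr x j = 0) (j : ι) (hj : i ≤ j) : w.repr x j = 0 := by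
  have := b.invertibleToMatrix w
  have h1 : (b.toMatrix w).BlockTriangular id := fun k l hkl => h l k hkl
  have h2 := Matrix.blockTriangular_inv_of_blockTriangular h1
  have h3 : (b.toMatrix w)⁻¹ = w.toMatrix b :=
    Matrix.inv_eq_left_inv (w.toMatrix_mul_toMatrix_flip b)
  rw [h3] at h2
  rw [← b.toMatrix_mulVec_repr w x]
  refine Finset.sum_eq_zero fun k _ => ?_
  change w.toMatrix b j k * b.repr x k = 0
  rcases lt_or_ge k i with hk | hk
  · rw [h2 (hk.trans_le hj : k < j), zero_mul]
  · rw [hx k hk, mul_zero]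

theorem repr_eq_zero_of_triangular_rev {n : ℕ} (b w : Module.Basis (Fin n) F V)
    (h : ∀ i j, j < i → b.repr (w i) j = 0) {x : V} {i : Fin n}
    (hx : ∀ j, j ≤ i → b.repr x j = 0) (j : Fin n) (hj : j ≤ i) : w.repr x j = 0 := by
  have := repr_eq_zero_of_triangular (b.reindex Fin.revPerm) (w.reindex Fin.revPerm)
    (fun k l hkl => by simpa using h _ _ (Fin.rev_lt_rev.2 hkl)) (x := x) (i := i.rev)
    (fun k hk => by simpa using hx k.rev (by simpa using Fin.rev_le_rev.2 hk)) j.rev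
    (Fin.rev_le_rev.2 hj)
  simpa using this

/-! ### Eigenvectors and primitive idempotents. -/

namespace IsPrimitiveIdempotents

variable {A : Module.End F V} {E : Fin (d + 1) → Module.End F V} {θ : Fin (d + 1) → F}

theorem apply_of_mem_range (h : IsPrimitiveIdempotents A E θ) {i : Fin (d + 1)} {v : V}
    (hv : v ∈ LinearMap.range (E i)) : A v = θ i • v := by
  obtain ⟨x, rfl⟩ := hv
  exact Module.End.mem_eigenspace_iff.1 (h.apply_mem i x)

theorem idem_apply_of_mem_range (h : IsPrimitiveIdempotents A E θ) {i : Fin (d + 1)} {v : V}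
    (hv : v ∈ LinearMap.range (E i)) : E i v = v :=
  h.apply_self i v (Module.End.mem_eigenspace_iff.2 (h.apply_of_mem_range hv))

theorem mem_range_iff (h : IsPrimitiveIdempotents A E θ) {i : Fin (d + 1)} {v : V} :
    v ∈ LinearMap.range (E i) ↔ A v = θ i • v :=
  ⟨h.apply_of_mem_range, fun hv => ⟨v, h.apply_self i v (Module.End.mem_eigenspace_iff.2 hv)⟩⟩

/-- `E i` commutes with `A`. -/
theorem idem_apply_apply (h : IsPrimitiveIdempotents A E θ) (i : Fin (d + 1)) (x : V) :
    E i (A x) = θ i • E i x := by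
  have hx : x ∈ ⨆ μ, A.eigenspace μ := by rw [h.multiplicityFree.1]; trivial
  induction hx using Submodule.iSup_induction' with
  | mem μ x hx =>
    rw [Module.End.mem_eigenspace_iff.1 hx, map_smul]
    by_cases h0 : x = 0
    · simp [h0]
    · obtain ⟨j, rfl⟩ := (h.hasEigenvalue_iff μ).1
        (Module.End.hasEigenvalue_of_hasEigenvector ⟨hx, h0⟩)
      by_cases hj : j = i
      · rw [hj]
      · rw [h.apply_other i j hj x hx, smul_zero, smul_zero]
  | zero => simp
  | add x y _ _ hx hy => rw [map_add, map_add, hx, hy, map_add, smul_add]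

theorem exists_mem_range (h : IsPrimitiveIdempotents A E θ) (i : Fin (d + 1)) :
    ∃ v ∈ LinearMap.range (E i), v ≠ 0 := by
  obtain ⟨v, hv, hv0⟩ := ((h.hasEigenvalue_iff _).2 ⟨i, rfl⟩).exists_hasEigenvector
  exact ⟨v, ⟨v, h.apply_self i v hv⟩, hv0⟩

theorem eigenvalue_unique (h : IsPrimitiveIdempotents A E θ) {θ' : Fin (d + 1) → F}
    (h' : IsPrimitiveIdempotents A E θ') : θ = θ' := by
  funext i
  obtain ⟨v, hv, hv0⟩ := h.exists_mem_range i
  exact smul_left_injective F hv0 ((h.apply_of_mem_range hv).symm.trans (h'.apply_of_mem_range hv))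

theorem repr_apply (h : IsPrimitiveIdempotents A E θ) {b : Module.Basis (Fin (d + 1)) F V}
    (hb : ∀ i, b i ∈ LinearMap.range (E i)) (x : V) (i : Fin (d + 1)) :
    b.repr (A x) i = θ i * b.repr x i := by
  have : (b.coord i) ∘ₗ A = θ i • b.coord i := by
    refine b.ext fun j => ?_
    by_cases hij : j = i
    · subst hij; simp [h.apply_of_mem_range (hb j)]
    · simp [h.apply_of_mem_range (hb j), hij]
  exact LinearMap.congr_fun this x

end IsPrimitiveIdempotents

theorem eval_nodal_eq_zero (α : ℕ → F) {k n : ℕ} (h : k < n) : (nodal α n).eval (α k) = 0 := by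
  rw [nodal, eval_prod]
  exact Finset.prod_eq_zero (Finset.mem_range.2 h) (by simp)

theorem repr_apply_eq_sum {ι : Type*} [Fintype ι] [DecidableEq ι] (b : Module.Basis ι F V)
    (X : Module.End F V) (x : V) (k : ι) :
    b.repr (X x) k = ∑ j, LinearMap.toMatrix b b X k j * b.repr x j := by
  rw [← LinearMap.toMatrix_mulVec_repr b b X x]
  rfl

end Leonard

/-! ### The split form of a Leonard system. -/

namespace LeonardSystem

open Leonard

variable {F V : Type*} [Field F] [AddCommGroup V] [Module F V] {d : ℕ}

/-- The `Φ`-split vectors `τ_n(A) v`, for all `n : ℕ`. -/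
noncomputable def splitVector (Φ : LeonardSystem F V d) (v : V) (n : ℕ) : V :=
  aeval Φ.A (nodal (extend Φ.th) n) v

theorem splitVector_zero (Φ : LeonardSystem F V d) (v : V) : Φ.splitVector v 0 = v := by
  simp [splitVector]

theorem splitVector_succ (Φ : LeonardSystem F V d) (v : V) (n : ℕ) :
    Φ.splitVector v (n + 1) =
      Φ.A (Φ.splitVector v n) - extend Φ.th n • Φ.splitVector v n :=
  aeval_nodal_succ _ _ _ _

theorem splitBasis_apply (Φ : LeonardSystem F V d) (v : V)
    (hv : v ∈ LinearMap.range (Φ.Estar 0)) (hv0 : v ≠ 0) (i : Fin (d + 1)) :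
    Φ.splitBasis v hv hv0 i = Φ.splitVector v i := by
  rw [splitBasis, Module.Basis.mk_apply, tau_eq_nodal, splitVector]

theorem repr_splitVector_eq_zero (Φ : LeonardSystem F V d) (v : V)
    {c : Module.Basis (Fin (d + 1)) F V} (hc : ∀ i, c i ∈ LinearMap.range (Φ.E i)) {n : ℕ}
    {i : Fin (d + 1)} (hi : i.val < n) : c.repr (Φ.splitVector v n) i = 0 := by
  have := apply_aeval_of_smul (c.coord i) (fun x => Φ.th_spec.repr_apply hc x i)
    (nodal (extend Φ.th) n) v
  rw [← extend_val Φ.th i, eval_nodal_eq_zero _ hi, zero_smul] at this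
  exact this

/-- For n > d the polynomial has every eigenvalue of A as a root, so it annihilates all coordinates
in an eigenbasis. -/
theorem splitVector_eq_zero (Φ : LeonardSystem F V d) (v : V) {n : ℕ} (hn : d < n) :
    Φ.splitVector v n = 0 := by
  obtain ⟨c, hc, -⟩ := Φ.standard
  exact c.ext_elem fun i => by
    rw [Φ.repr_splitVector_eq_zero v hc (by omega)]; simp

/-- In an eigenbasis of A^* the operator A is tridiagonal, so each new factor raises the top index
by at most one, starting from v ∈ E^*_0 V. -/
theorem repr_star_splitVector_eq_zero (Φ : LeonardSystem F V d) {v : V}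
    (hv : v ∈ LinearMap.range (Φ.Estar 0)) {b : Module.Basis (Fin (d + 1)) F V}
    (hb : ∀ i, b i ∈ LinearMap.range (Φ.Estar i))
    (ht : IsIrreducibleTridiagonal (LinearMap.toMatrix b b Φ.A)) {n : ℕ} {j : Fin (d + 1)}
    (hj : n < j.val) : b.repr (Φ.splitVector v n) j = 0 := by
  induction n generalizing j with
  | zero =>
    obtain ⟨c, rfl⟩ := Φ.thstar_spec.exists_smul 0 (hb 0) (b.ne_zero 0) hv
    have : (0 : Fin (d + 1)) ≠ j := by rintro rfl; simp at hj
    simp [splitVector_zero, this]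
  | succ n ih =>
    rw [splitVector_succ, map_sub, Finsupp.sub_apply, map_smul, Finsupp.smul_apply, ih (by omega),
      smul_zero, sub_zero, repr_apply_eq_sum]
    refine Finset.sum_eq_zero fun k _ => ?_
    rcases lt_or_ge n k.val with h | h
    · rw [ih h, mul_zero]
    · rw [ht.1 _ _ (by omega), zero_mul]

/-- The split form of a Leonard system. -/
theorem isSplitChain (Φ : LeonardSystem F V d) {v : V} (hv : v ∈ LinearMap.range (Φ.Estar 0))
    (hv0 : v ≠ 0) :
    IsSplitChain Φ.A Φ.Astar (extend Φ.th) (extend Φ.thstar) (extendZero Φ.firstSplit)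
      (Φ.splitVector v) := by
  set w := Φ.splitBasis v hv hv0 with hw
  have hwi : ∀ i, w i = Φ.splitVector v i := Φ.splitBasis_apply v hv hv0
  obtain ⟨b, hb, ht, -⟩ := Φ.standard_star
  obtain ⟨c, hc, ht', -⟩ := Φ.standard
  -- In the eigenbasis b of A^*, w_i involves only indices up to i, and A^* - θ^*_i removes index i.
  -- Triangularity transfers this to coordinates in w.
  have upper : ∀ i j : Fin (d + 1), i ≤ j →
      w.repr (Φ.Astar (w i) - Φ.thstar i • w i) j = 0 := by
    intro i
    refine repr_eq_zero_of_triangular b w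
      (fun i j hij => by rw [hwi]; exact Φ.repr_star_splitVector_eq_zero hv hb ht hij) ?_
    intro j hj
    rw [map_sub, Finsupp.sub_apply, map_smul, Finsupp.smul_apply, Φ.thstar_spec.repr_apply hb,
      smul_eq_mul, ← sub_mul]
    rcases hj.eq_or_lt with rfl | hj
    · rw [sub_self, zero_mul]
    · rw [hwi, Φ.repr_star_splitVector_eq_zero hv hb ht hj, mul_zero]
  -- In the eigenbasis c of A, w_i involves only indices from i on, and the tridiagonal A^* lowers
  -- indices by at most one. With `upper`, only the coordinate i - 1 can remain.
  have lower : ∀ i j : Fin (d + 1), j.val + 1 < i.val →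
      w.repr (Φ.Astar (w i) - Φ.thstar i • w i) j = 0 := by
    intro i j hij
    refine repr_eq_zero_of_triangular_rev c w
      (fun i j hij => by rw [hwi]; exact Φ.repr_splitVector_eq_zero v hc hij) ?_ j le_rfl
    intro k hk
    have hk' : k.val ≤ j.val := hk
    rw [map_sub, Finsupp.sub_apply, map_smul, Finsupp.smul_apply, repr_apply_eq_sum, hwi,
      Φ.repr_splitVector_eq_zero v hc (by omega), smul_zero, sub_zero]
    refine Finset.sum_eq_zero fun l _ => ?_
    rcases lt_or_ge l.val i.val with h | h
    · rw [Φ.repr_splitVector_eq_zero v hc h, mul_zero]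
    · rw [ht'.1 _ _ (by omega), zero_mul]
  refine ⟨fun n => ?_, ?_, fun n => ?_⟩
  · rw [splitVector_succ]; abel
  · rw [splitVector_zero, Φ.thstar_spec.apply_of_mem_range hv, ← extend_val Φ.thstar 0]
    rfl
  · by_cases hn : n < d
    · let i : Fin d := ⟨n, hn⟩
      have h1 : Φ.Astar (w i.succ) - Φ.thstar i.succ • w i.succ =
          Φ.firstSplit i • w i.castSucc := by
        refine w.ext_elem fun j => ?_
        have hne : i.succ ≠ i.castSucc := fun h => by simp [Fin.ext_iff] at h
        by_cases hj : j = i.castSucc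
        · subst hj
          rw [Φ.firstSplit_eq v hv hv0, LinearMap.toMatrix_apply]
          simp [hne, ← hw]
        · have : (w.repr (Φ.firstSplit i • w i.castSucc)) j = 0 := by
            simp [Ne.symm hj]
          rw [this]
          rcases le_or_gt i.succ j with h | h
          · exact upper _ _ h
          · refine lower _ _ ?_
            have h2 : j.val < n + 1 := h
            have h3 : j.val ≠ n := fun h3 => hj (Fin.ext h3)
            change j.val + 1 < n + 1
            omega
      have h2 := extend_val Φ.thstar i.succ
      rw [hwi, hwi, sub_eq_iff_eq_add'] at h1
      rw [← h2] at h1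
      simpa [extendZero, hn, i] using h1
    -- At n = d the vector y_{d+1} is zero but y_d is not, so the padded split sequence has to be
    -- zero there.
    · rw [Φ.splitVector_eq_zero v (by omega)]
      simp [extendZero, hn]

theorem splitVector_ne_zero (Φ : LeonardSystem F V d) {v : V}
    (hv : v ∈ LinearMap.range (Φ.Estar 0)) (hv0 : v ≠ 0) {n : ℕ} (hn : n ≤ d) :
    Φ.splitVector v n ≠ 0 := by
  have := (Φ.splitBasis v hv hv0).ne_zero ⟨n, by omega⟩
  rwa [splitBasis_apply] at this

/-- This is y_{d+1} = 0 read as (A - θ_d) y_d = 0. -/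
theorem splitVector_last_mem (Φ : LeonardSystem F V d) (v : V) :
    Φ.splitVector v d ∈ LinearMap.range (Φ.E (Fin.last d)) := by
  have h := Φ.splitVector_succ v d
  rw [Φ.splitVector_eq_zero v (by omega)] at h
  rw [Φ.th_spec.mem_range_iff, ← extend_val Φ.th (Fin.last d)]
  exact (sub_eq_zero.1 h.symm)

theorem th_Down (Φ : LeonardSystem F V d) : Φ.Down.th = fun i => Φ.th i.rev :=
  Φ.Down.th_spec.eigenvalue_unique Φ.th_spec.rev

theorem extend_th_Down (Φ : LeonardSystem F V d) (k : ℕ) :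
    extend Φ.Down.th k = extend Φ.th (d - k) := by
  rw [th_Down, extend_rev]

/-- Descending from y_d to y_0 by the factors of A^* produces the product of the whole sequence. The
result is also the last vector of a split basis of another relative of Φ, hence nonzero. -/
theorem firstSplit_ne_zero (Φ : LeonardSystem F V d) {n : ℕ} (hn : n < d) :
    extendZero Φ.firstSplit n ≠ 0 := by
  obtain ⟨v, hv, hv0⟩ := Φ.exists_ne_zero
  have h := (Φ.isSplitChain hv hv0).aeval_nodal_rev (le_refl d)
  -- `Φ.Down.dual.Down` is (A^*; E^*_{d-i}; A; E_{d-i}): its split bases start in E_d V, where y_d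
  -- lies, and use the polynomials η^*_i(A^*).
  have h1 := Φ.Down.dual.Down.splitVector_ne_zero (v := Φ.splitVector v d) (n := d)
    (by simpa [Down, dual] using Φ.splitVector_last_mem v) (Φ.splitVector_ne_zero hv hv0 le_rfl)
    le_rfl
  rw [splitVector, nodal_congr (fun k _ => extend_th_Down _ k)] at h1
  have h2 : (∏ k ∈ Finset.range d, extendZero Φ.firstSplit (d - 1 - k)) ≠ 0 := fun h0 =>
    h1 (h.trans (by rw [h0, zero_smul]))
  have := Finset.prod_ne_zero_iff.1 h2 (d - 1 - n) (Finset.mem_range.2 (by omega))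
  rwa [show d - 1 - (d - 1 - n) = n by omega] at this

end LeonardSystem

/-! ### The invariant bilinear form and the split sequence of the dual system. -/

namespace Leonard

variable {F V : Type*} [Field F] [AddCommGroup V] [Module F V] {d : ℕ}

/-- An irreducible tridiagonal matrix is symmetrized by an invertible diagonal matrix. -/
theorem IsIrreducibleTridiagonal.exists_symmetrizer
    {M : Matrix (Fin (d + 1)) (Fin (d + 1)) F} (h : IsIrreducibleTridiagonal M) :
    ∃ k : Fin (d + 1) → F, (∀ i, k i ≠ 0) ∧ ∀ i j, k i * M i j = k j * M j i := by
  -- The symmetry forces k_{n+1} / k_n = M_{n,n+1} / M_{n+1,n}, so k is a product of these ratios.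
  -- The value 1 from d on is never used by k.
  let r : ℕ → F := fun n => if hn : n < d then
    M (Fin.castSucc ⟨n, hn⟩) (Fin.succ ⟨n, hn⟩) / M (Fin.succ ⟨n, hn⟩) (Fin.castSucc ⟨n, hn⟩) else 1
  have hr : ∀ n, r n ≠ 0 := by
    intro n
    by_cases hn : n < d
    · simp only [r, hn, dif_pos]
      exact div_ne_zero (h.2 _ _ (Or.inl rfl)) (h.2 _ _ (Or.inr rfl))
    · simp [r, hn]
  let k : Fin (d + 1) → F := fun i => ∏ n ∈ Finset.range i.val, r n
  have key : ∀ i j : Fin (d + 1), i.val + 1 = j.val → k i * M i j = k j * M j i := by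
    rintro ⟨i, hi⟩ ⟨j, hj⟩ hij
    simp only at hij
    subst hij
    have hM : M ⟨i + 1, hj⟩ ⟨i, hi⟩ ≠ 0 := h.2 _ _ (Or.inr rfl)
    have hri : r i = M ⟨i, hi⟩ ⟨i + 1, hj⟩ / M ⟨i + 1, hj⟩ ⟨i, hi⟩ := dif_pos (by omega)
    simp only [k, Finset.prod_range_succ, hri]
    field_simp
  refine ⟨k, fun i => Finset.prod_ne_zero_iff.2 fun n _ => hr n, fun i j => ?_⟩
  by_cases h1 : i.val + 1 = j.val
  · exact key i j h1
  by_cases h2 : j.val + 1 = i.val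
  · exact (key j i h2).symm
  by_cases h3 : i = j
  · rw [h3]
  · have h4 : i.val ≠ j.val := fun h4 => h3 (Fin.ext h4)
    rw [h.1 i j (by omega), h.1 j i (by omega), mul_zero, mul_zero]

theorem bilin_aeval {A : Module.End F V} {B : V →ₗ[F] V →ₗ[F] F}
    (h : ∀ x y, B (A x) y = B x (A y)) (p : F[X]) (x y : V) :
    B (aeval A p x) y = B x (aeval A p y) := by
  induction p using Polynomial.induction_on generalizing x y with
  | C a => simp [Module.algebraMap_end_apply]
  | add p q hp hq => simp [hp, hq]
  | monomial n a ih =>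
    have h1 : aeval A (C a * X ^ (n + 1)) x = aeval A (C a * X ^ n) (A x) := by
      rw [pow_succ, ← mul_assoc, map_mul (aeval A) _ X, Module.End.mul_apply, aeval_X]
    have h2 : aeval A (C a * X ^ (n + 1)) y = A (aeval A (C a * X ^ n) y) := by
      rw [pow_succ, ← mul_assoc, mul_comm, map_mul (aeval A) X, Module.End.mul_apply, aeval_X]
    rw [h1, h2, ih, h]

theorem prod_extendZero (f : Fin d → F) {i : ℕ} (hi : i ≤ d) :
    ∏ k : Fin d with k.val < i, f k = ∏ k ∈ Finset.range i, extendZero f k := by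
  have h1 := Fin.prod_univ_eq_prod_range (fun k => if k < i then extendZero f k else 1) d
  have h2 : (Finset.range d).filter (· < i) = Finset.range i := by
    ext k
    simp only [Finset.mem_filter, Finset.mem_range]
    omega
  rw [Finset.prod_filter, ← h2, Finset.prod_filter, ← h1]
  exact Finset.prod_congr rfl fun k _ => by simp [extendZero]

end Leonard

namespace LeonardSystem

open Leonard

variable {F V : Type*} [Field F] [AddCommGroup V] [Module F V] {d : ℕ}

/-- There is a nondegenerate symmetric bilinear form for which `A` and `A^*` are self-adjoint. -/
theorem exists_invariant_form (Φ : LeonardSystem F V d) :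
    ∃ B : V →ₗ[F] V →ₗ[F] F, (∀ x y, B x y = B y x) ∧ (∀ x y, B (Φ.A x) y = B x (Φ.A y)) ∧
      (∀ x y, B (Φ.Astar x) y = B x (Φ.Astar y)) ∧ ∀ x, (∀ y, B x y = 0) → x = 0 := by
  obtain ⟨c, hc, ht, -⟩ := Φ.standard
  obtain ⟨k, hk0, hk⟩ := ht.exists_symmetrizer
  -- The eigenbasis c of A is made orthogonal, so A is self-adjoint for any weights; the symmetrizer
  -- k of the matrix of A^* is the choice that makes A^* self-adjoint too.
  let B : V →ₗ[F] V →ₗ[F] F := LinearMap.mk₂ F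
    (fun x y => ∑ i, k i * c.repr x i * c.repr y i)
    (fun x y z => by simp [mul_add, add_mul, Finset.sum_add_distrib])
    (fun a x y => by
      simp only [map_smul, Finsupp.smul_apply, smul_eq_mul, Finset.mul_sum]
      exact Finset.sum_congr rfl fun i _ => by ring)
    (fun x y z => by simp [mul_add, Finset.sum_add_distrib])
    (fun a x y => by
      simp only [map_smul, Finsupp.smul_apply, smul_eq_mul, Finset.mul_sum]
      exact Finset.sum_congr rfl fun i _ => by ring)
  have hB : ∀ x y, B x y = ∑ i, k i * c.repr x i * c.repr y i := fun x y => rfl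
  refine ⟨B, fun x y => ?_, fun x y => ?_, fun x y => ?_, fun x hx => ?_⟩
  · rw [hB, hB]
    exact Finset.sum_congr rfl fun i _ => by ring
  · rw [hB, hB]
    refine Finset.sum_congr rfl fun i _ => ?_
    rw [Φ.th_spec.repr_apply hc, Φ.th_spec.repr_apply hc]
    ring
  · rw [hB, hB]
    simp only [repr_apply_eq_sum, Finset.mul_sum, Finset.sum_mul]
    rw [Finset.sum_comm]
    refine Finset.sum_congr rfl fun i _ => Finset.sum_congr rfl fun j _ => ?_
    linear_combination (c.repr x i * c.repr y j) * hk j i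
  · refine c.ext_elem fun i => ?_
    have := hx (c i)
    rw [hB, Finset.sum_eq_single i] at this
    · simpa [hk0 i] using this
    · intro j _ hj
      simp [Ne.symm hj]
    · simp

/-- Dual Leonard systems have the same first split sequence. -/
theorem extendZero_firstSplit_dual (Φ : LeonardSystem F V d) {n : ℕ} (hn : n < d) :
    extendZero Φ.dual.firstSplit n = extendZero Φ.firstSplit n := by
  obtain ⟨B, hsymm, hA, hAs, hnd⟩ := Φ.exists_invariant_form
  obtain ⟨v, hv, hv0⟩ := Φ.exists_ne_zero
  obtain ⟨v', hv', hv0'⟩ := Φ.dual.exists_ne_zero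
  have c1 := Φ.isSplitChain hv hv0
  have c2 := Φ.dual.isSplitChain hv' hv0'
  have hf : ∀ x, B v' (Φ.A x) = extend Φ.th 0 • B v' x := by
    intro x
    rw [← hA, Φ.th_spec.apply_of_mem_range hv', map_smul, LinearMap.smul_apply,
      ← extend_val Φ.th 0]
    rfl
  have hg : ∀ x, B v (Φ.Astar x) = extend Φ.thstar 0 • B v x := by
    intro x
    rw [← hAs, Φ.thstar_spec.apply_of_mem_range hv, map_smul, LinearMap.smul_apply,
      ← extend_val Φ.thstar 0]
    rfl
  -- B(v', ·) is a θ_0-eigenfunctional of A, so it kills every τ_n(A)v with n > 0. If it killed v as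
  -- well it would vanish on a basis, against nondegeneracy.
  have hne : B v' v ≠ 0 := by
    intro h0
    refine hv0' (hnd v' fun y => ?_)
    have : B v' = 0 := by
      refine (Φ.splitBasis v hv hv0).ext fun i => ?_
      rw [splitBasis_apply, LinearMap.zero_apply]
      cases i.val with
      | zero => rw [splitVector_zero, h0]
      | succ n => exact c1.apply_succ_eq_zero _ hf n
    rw [this, LinearMap.zero_apply]
  have hprod : ∀ i, ∏ k ∈ Finset.range i, extendZero Φ.dual.firstSplit k =
      ∏ k ∈ Finset.range i, extendZero Φ.firstSplit k := by
    intro i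
    have h1 := c1.apply_aeval_nodal _ hf i i
    have h2 := c2.apply_aeval_nodal _ hg i i
    rw [if_pos rfl, splitVector_zero, smul_eq_mul] at h1 h2
    refine mul_right_cancel₀ hne (Eq.trans ?_ h1)
    rw [hsymm v' v, ← h2]
    -- Both partial products are read off one number: self-adjointness moves τ_i(A) and τ^*_i(A^*)
    -- across the form, and symmetry swaps v and v'.
    change B v (aeval Φ.A _ (aeval Φ.Astar _ v')) = B v' (aeval Φ.Astar _ (aeval Φ.A _ v))
    rw [← bilin_aeval hA, ← bilin_aeval hAs, hsymm]
    rfl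
  have h := hprod (n + 1)
  rw [Finset.prod_range_succ, Finset.prod_range_succ, hprod n] at h
  exact mul_left_cancel₀ (Finset.prod_ne_zero_iff.2 fun k hk =>
    Φ.firstSplit_ne_zero ((Finset.mem_range.1 hk).trans hn)) h

/-! ### The scalar of E^*_0 E_d E^*_0, and the action of T without a duality. -/

/-- The scalar `φ_1 ⋯ φ_d / (τ_d(θ_d) η_d(θ_0))` formed with the first split sequence. -/
noncomputable def splitScalar (Φ : LeonardSystem F V d) : F :=
  (∏ k : Fin d, Φ.firstSplit k) / ((tau Φ.th (Fin.last d)).eval (Φ.th (Fin.last d)) *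
    (eta Φ.th (Fin.last d)).eval (Φ.th 0))

theorem prod_firstSplit (Φ : LeonardSystem F V d) :
    ∏ k : Fin d, Φ.firstSplit k = ∏ k ∈ Finset.range d, extendZero Φ.firstSplit k := by
  rw [← prod_extendZero _ le_rfl]
  simp

theorem prod_extendZero_firstSplit_ne_zero (Φ : LeonardSystem F V d) {i : ℕ} (hi : i ≤ d) :
    ∏ k ∈ Finset.range i, extendZero Φ.firstSplit k ≠ 0 :=
  Finset.prod_ne_zero_iff.2 fun _ hk =>
    Φ.firstSplit_ne_zero ((Finset.mem_range.1 hk).trans_le hi)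

theorem eval_tau_last_ne_zero (Φ : LeonardSystem F V d) :
    (tau Φ.th (Fin.last d)).eval (Φ.th (Fin.last d)) ≠ 0 := by
  rw [tau, eval_prod]
  refine Finset.prod_ne_zero_iff.2 fun k hk => ?_
  have hk' : Fin.last d ≠ k := (Finset.mem_filter.1 hk).2.ne'
  simpa [sub_eq_zero] using fun h => hk' (Φ.th_spec.injective h)

theorem eval_eta_last_ne_zero (Φ : LeonardSystem F V d) :
    (eta Φ.th (Fin.last d)).eval (Φ.th 0) ≠ 0 := by
  have := Φ.Down.eval_tau_last_ne_zero
  rw [th_Down, ← eta_eq_tau] at this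
  simpa using this

theorem splitScalar_ne_zero (Φ : LeonardSystem F V d) : Φ.splitScalar ≠ 0 := by
  refine div_ne_zero ?_ (mul_ne_zero Φ.eval_tau_last_ne_zero Φ.eval_eta_last_ne_zero)
  rw [prod_firstSplit]
  exact Φ.prod_extendZero_firstSplit_ne_zero le_rfl

/-- `E^*_0 E_d` acts on `E^*_0 V` as a scalar. -/
theorem star_zero_idem_last_apply (Φ : LeonardSystem F V d) (hth : Φ.thstar = Φ.th) {v : V}
    (hv : v ∈ LinearMap.range (Φ.Estar 0)) :
    Φ.Estar 0 (Φ.E (Fin.last d) v) = Φ.splitScalar • v := by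
  by_cases hv0 : v = 0
  · simp [hv0]
  have h1 := (Φ.isSplitChain hv hv0).aeval_nodal_rev (le_refl d)
  -- As τ_d(A)v lies in E_d V, it equals E_d τ_d(A)v = τ_d(θ_d) E_d v. Applying E^*_0 η^*_d(A^*) to
  -- both forms of this vector then yields the scalar.
  have h2 : Φ.splitVector v d =
      (tau Φ.th (Fin.last d)).eval (Φ.th (Fin.last d)) • Φ.E (Fin.last d) v := by
    rw [← Φ.th_spec.idem_apply_of_mem_range (Φ.splitVector_last_mem v), splitVector,
      apply_aeval_of_smul _ (Φ.th_spec.idem_apply_apply _), tau_eq_nodal]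
    rfl
  have h3 := congrArg (Φ.Estar 0) h1
  have h4 : nodal (fun k => extend Φ.thstar (d - k)) d = eta Φ.th (Fin.last d) := by
    rw [eta_eq_nodal, hth]
    rfl
  rw [apply_aeval_of_smul _ (Φ.thstar_spec.idem_apply_apply _), h2, map_smul, map_smul,
    Nat.sub_self, splitVector_zero, Φ.thstar_spec.idem_apply_of_mem_range hv,
    Finset.prod_range_reflect, ← prod_firstSplit, smul_smul, h4, hth] at h3
  have h5 := Φ.eval_tau_last_ne_zero
  have h6 := Φ.eval_eta_last_ne_zero
  rw [splitScalar, div_eq_inv_mul, mul_smul, ← h3, smul_smul, mul_comm (eval _ (eta _ _)),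
    inv_mul_cancel₀ (mul_ne_zero h5 h6), one_smul]

theorem T_apply (Φ : LeonardSystem F V d) (x : V) :
    Φ.T x = ∑ i : Fin (d + 1), aeval Φ.A (nodal (extend Φ.Down.th) i.rev)
      (Φ.Estar 0 (Φ.E (Fin.last d) (aeval Φ.Astar (nodal (extend Φ.thstar) i) x))) := by
  rw [T, LinearMap.sum_apply]
  refine Finset.sum_congr rfl fun i _ => ?_
  rw [eta_eq_tau, ← th_Down, tau_eq_nodal, tau_eq_nodal]
  rfl

theorem idem_last_apply_A (Φ : LeonardSystem F V d) (x : V) :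
    Φ.E (Fin.last d) (Φ.A x) = extend Φ.Down.th 0 • Φ.E (Fin.last d) x := by
  rw [Φ.th_spec.idem_apply_apply, extend_th_Down, Nat.sub_zero,
    ← extend_val Φ.th (Fin.last d)]
  rfl

/-- `T` is antidiagonal on the split basis `{η_i(A) v}` with `v ∈ E^*_0 V`. -/
theorem T_splitVector_Down (Φ : LeonardSystem F V d) (hth : Φ.thstar = Φ.th) {v : V}
    (hv : v ∈ LinearMap.range (Φ.Estar 0)) (hv0 : v ≠ 0) {j : ℕ} (hj : j ≤ d) :
    Φ.T (Φ.Down.splitVector v j) =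
      (Φ.splitScalar * ∏ k ∈ Finset.range j, extendZero Φ.secondSplit k) •
        Φ.Down.splitVector v (d - j) := by
  have c := Φ.Down.isSplitChain hv hv0
  have h := c.apply_aeval_nodal (Φ.E (Fin.last d)) Φ.idem_last_apply_A
  rw [T_apply, Finset.sum_eq_single ⟨j, by omega⟩]
  · have h1 := h j j
    rw [if_pos rfl, splitVector_zero] at h1
    change aeval Φ.A _ (Φ.Estar 0 (Φ.E (Fin.last d)
      (aeval Φ.Down.Astar (nodal (extend Φ.Down.thstar) j) _))) = _
    rw [h1, map_smul, Φ.star_zero_idem_last_apply hth hv, map_smul, map_smul, smul_smul, mul_comm]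
    have h2 : (Fin.rev ⟨j, by omega⟩ : Fin (d + 1)).val = d - j := by
      simp only [Fin.val_rev]; omega
    rw [h2]
    rfl
  · intro i _ hij
    have h1 := h i j
    rw [if_neg (fun h => hij (Fin.ext h))] at h1
    change aeval Φ.A _ (Φ.Estar 0 (Φ.E (Fin.last d)
      (aeval Φ.Down.Astar (nodal (extend Φ.Down.thstar) i) _))) = _
    rw [h1, map_zero, map_zero]
  · simp

/-- `E_d T = κ E_d τ^*_d(A^*)` with `κ` the scalar of `E^*_0 E_d E^*_0 = κ E^*_0`. -/
theorem idem_last_T_apply (Φ : LeonardSystem F V d) (hth : Φ.thstar = Φ.th) (x : V) :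
    Φ.E (Fin.last d) (Φ.T x) = Φ.splitScalar •
      Φ.E (Fin.last d) (aeval Φ.Astar (nodal (extend Φ.thstar) d) x) := by
  -- E_d V is a line, spanned by E_d v for 0 ≠ v ∈ E^*_0 V; this vector is nonzero because E^*_0
  -- sends it to κ v.
  have key : ∀ z, Φ.E (Fin.last d) (Φ.Estar 0 (Φ.E (Fin.last d) z)) =
      Φ.splitScalar • Φ.E (Fin.last d) z := by
    intro z
    obtain ⟨v, hv, hv0⟩ := Φ.exists_ne_zero
    have h1 := Φ.star_zero_idem_last_apply hth hv
    have h2 : Φ.E (Fin.last d) v ≠ 0 := by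
      intro h2
      rw [h2, map_zero] at h1
      exact smul_ne_zero Φ.splitScalar_ne_zero hv0 h1.symm
    obtain ⟨a, ha⟩ := Φ.th_spec.exists_smul (Fin.last d) ⟨v, rfl⟩ h2
      (LinearMap.mem_range_self (Φ.E (Fin.last d)) z)
    rw [← ha, map_smul, map_smul, h1, map_smul, smul_comm]
  -- E_d η_{d-i}(A) = η_{d-i}(θ_d) E_d, and θ_d is a root of η_{d-i} unless i = d.
  rw [T_apply, map_sum, Finset.sum_eq_single (Fin.last d)]
  · rw [apply_aeval_of_smul _ Φ.idem_last_apply_A, key]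
    simp
  · intro i _ hi
    have h1 : 0 < i.rev.val := by
      have : i.val ≠ d := fun h => hi (Fin.ext h)
      simp only [Fin.val_rev]
      omega
    rw [apply_aeval_of_smul _ Φ.idem_last_apply_A, eval_nodal_eq_zero _ h1, zero_smul]
  · simp

/-! ### Dualities, and T as one of them. -/

/-- A self-dual Leonard system has a linear duality, by the Skolem-Noether theorem. -/
theorem IsSelfDual.exists_linearEquiv {Φ : LeonardSystem F V d} (h : Φ.IsSelfDual) :
    ∃ S : V ≃ₗ[F] V, (∀ x, S (Φ.A x) = Φ.Astar (S x)) ∧ (∀ x, S (Φ.Astar x) = Φ.A (S x)) ∧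
      (∀ i x, S (Φ.E i x) = Φ.Estar i (S x)) ∧ ∀ i x, S (Φ.Estar i x) = Φ.E i (S x) := by
  obtain ⟨σ, h1, h2, h3, h4⟩ := h
  obtain ⟨S, rfl⟩ := σ.eq_linearEquivConjAlgEquiv
  have key : ∀ {X Y : Module.End F V}, S.conjAlgEquiv F X = Y → ∀ x, S (X x) = Y (S x) := by
    rintro X _ rfl x
    simp [LinearEquiv.conjAlgEquiv_apply]
  exact ⟨S, key h1, key h3, fun i => key (h2 i), fun i => key (h4 i)⟩

theorem IsSelfDual.thstar_eq_th {Φ : LeonardSystem F V d} (h : Φ.IsSelfDual) :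
    Φ.thstar = Φ.th := by
  obtain ⟨S, hA, -, hE, -⟩ := h.exists_linearEquiv
  funext i
  obtain ⟨v, hv, hv0⟩ := Φ.th_spec.exists_mem_range i
  have h1 : S v ∈ LinearMap.range (Φ.Estar i) :=
    ⟨S v, by rw [← hE, Φ.th_spec.idem_apply_of_mem_range hv]⟩
  have h2 := Φ.thstar_spec.apply_of_mem_range h1
  rw [← hA, Φ.th_spec.apply_of_mem_range hv, map_smul] at h2
  exact smul_left_injective F (S.map_ne_zero_iff.2 hv0) h2.symm

theorem secondSplit_ne_zero (Φ : LeonardSystem F V d) {n : ℕ} (hn : n < d) :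
    extendZero Φ.secondSplit n ≠ 0 :=
  Φ.Down.firstSplit_ne_zero hn

/-- A duality inverts the split basis `{η_i(A) v}`, up to scalars. -/
theorem duality_splitVector_Down (Φ : LeonardSystem F V d) (hth : Φ.thstar = Φ.th) {v : V}
    (hv : v ∈ LinearMap.range (Φ.Estar 0)) (hv0 : v ≠ 0) (S : V ≃ₗ[F] V)
    (hA : ∀ x, S (Φ.A x) = Φ.Astar (S x)) (hEs : ∀ i x, S (Φ.Estar i x) = Φ.E i (S x)) :
    ∃ c : F, c ≠ 0 ∧ ∀ j ≤ d, S (Φ.Down.splitVector v j) =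
      (c * ∏ k ∈ Finset.range j, extendZero Φ.secondSplit (d - 1 - k)) •
        Φ.Down.splitVector v (d - j) := by
  have h1 : Φ.Down.splitVector v d ∈ LinearMap.range (Φ.E 0) := by
    simpa [Down] using Φ.Down.splitVector_last_mem v
  have h2 : S v ∈ LinearMap.range (Φ.E 0) :=
    ⟨S v, by rw [← hEs, Φ.thstar_spec.idem_apply_of_mem_range hv]⟩
  obtain ⟨c, hc⟩ := Φ.th_spec.exists_smul 0 h1 (Φ.Down.splitVector_ne_zero hv hv0 le_rfl) h2
  refine ⟨c, ?_, fun j hj => ?_⟩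
  · rintro rfl
    exact S.map_ne_zero_iff.2 hv0 (by simpa using hc.symm)
  · have h3 := (Φ.Down.isSplitChain hv hv0).aeval_nodal_rev (m := d) hj
    have h4 : S (Φ.Down.splitVector v j) =
        aeval Φ.Astar (nodal (extend Φ.Down.th) j) (S v) :=
      apply_aeval S.toLinearMap hA _ v
    have h5 : nodal (extend Φ.Down.th) j = nodal (fun k => extend Φ.Down.thstar (d - k)) j := by
      refine nodal_congr fun k _ => ?_
      rw [extend_th_Down, ← hth]
      rfl
    rw [h4, h5, ← hc, map_smul, mul_smul]
    exact congrArg (c • ·) h3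

/-- The second split sequence of a self-dual Leonard system is a palindrome. -/
theorem IsSelfDual.secondSplit_rev {Φ : LeonardSystem F V d} (h : Φ.IsSelfDual) {j : ℕ}
    (hj : j < d) : extendZero Φ.secondSplit (d - 1 - j) = extendZero Φ.secondSplit j := by
  have hth := h.thstar_eq_th
  obtain ⟨S, hA, hAs, -, hEs⟩ := h.exists_linearEquiv
  obtain ⟨v, hv, hv0⟩ := Φ.exists_ne_zero
  obtain ⟨c, hc0, hc⟩ := Φ.duality_splitVector_Down hth hv hv0 S hA hEs
  have hch := Φ.Down.isSplitChain hv hv0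
  set y := Φ.Down.splitVector v with hy
  set P := ∏ k ∈ Finset.range j, extendZero Φ.secondSplit (d - 1 - k) with hP
  have hP0 : P ≠ 0 := Finset.prod_ne_zero_iff.2 fun k hk => Φ.secondSplit_ne_zero (by omega)
  have e1 := hc j hj.le
  have e2 := hc (j + 1) hj
  rw [Finset.prod_range_succ, ← hP] at e2
  rw [← hP] at e1
  have l1 : Φ.Astar (y (j + 1)) =
      extend Φ.thstar (j + 1) • y (j + 1) + extendZero Φ.secondSplit j • y j := hch.lower j
  have l2 : Φ.A (y (d - (j + 1))) = extend Φ.thstar (j + 1) • y (d - (j + 1)) + y (d - j) := by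
    have := hch.raise (d - (j + 1))
    rw [extend_th_Down, ← hth, show d - (d - (j + 1)) = j + 1 by omega,
      show d - (j + 1) + 1 = d - j by omega] at this
    exact this
  -- S turns A^* on y_{j+1} into A on a multiple of y_{d-j-1}. The diagonal terms agree because θ^*
  -- = θ, and what is left compares the coefficients of y_{d-j}.
  have l3 := congrArg S l1
  rw [hAs, map_add, map_smul, map_smul, e1, e2, map_smul, l2, smul_add, smul_comm,
    add_right_inj, smul_smul] at l3
  have hne : y (d - j) ≠ 0 := Φ.Down.splitVector_ne_zero hv hv0 (by omega)
  have l4 := smul_left_injective F hne l3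
  refine mul_left_cancel₀ (mul_ne_zero hc0 hP0) ?_
  linear_combination l4

theorem IsSelfDual.prod_secondSplit_rev {Φ : LeonardSystem F V d} (h : Φ.IsSelfDual) {j : ℕ}
    (hj : j ≤ d) : ∏ k ∈ Finset.range j, extendZero Φ.secondSplit (d - 1 - k) =
      ∏ k ∈ Finset.range j, extendZero Φ.secondSplit k :=
  Finset.prod_congr rfl fun _ hk => h.secondSplit_rev ((Finset.mem_range.1 hk).trans_le hj)

/-- `T` is a duality of a self-dual Leonard system. -/
theorem IsSelfDual.exists_T_eq {Φ : LeonardSystem F V d} (h : Φ.IsSelfDual) :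
    ∃ S : V ≃ₗ[F] V, (∀ x, S x = Φ.T x) ∧ (∀ x, S (Φ.A x) = Φ.Astar (S x)) ∧
      (∀ x, S (Φ.Astar x) = Φ.A (S x)) ∧ (∀ i x, S (Φ.E i x) = Φ.Estar i (S x)) ∧
      ∀ i x, S (Φ.Estar i x) = Φ.E i (S x) := by
  have hth := h.thstar_eq_th
  obtain ⟨S, hA, hAs, hE, hEs⟩ := h.exists_linearEquiv
  obtain ⟨v, hv, hv0⟩ := Φ.exists_ne_zero
  obtain ⟨c, hc0, hc⟩ := Φ.duality_splitVector_Down hth hv hv0 S hA hEs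
  -- On the y_j, both S and T are antidiagonal with the same products once the palindrome is used;
  -- only the leading scalars c and κ differ.
  have he : Φ.splitScalar / c ≠ 0 := div_ne_zero Φ.splitScalar_ne_zero hc0
  refine ⟨S.trans (LinearEquiv.smulOfNeZero F V _ he), fun x => ?_, ?_, ?_, ?_, ?_⟩
  · have : (S.trans (LinearEquiv.smulOfNeZero F V _ he)).toLinearMap = Φ.T := by
      have hv' : v ∈ LinearMap.range (Φ.Down.Estar 0) := hv
      refine (Φ.Down.splitBasis v hv' hv0).ext fun j => ?_
      have hj : j.val ≤ d := by omega
      rw [splitBasis_apply, Φ.T_splitVector_Down hth hv hv0 hj]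
      simp only [LinearEquiv.coe_coe, LinearEquiv.trans_apply, LinearEquiv.smulOfNeZero_apply]
      rw [hc j hj, h.prod_secondSplit_rev hj, smul_smul, ← mul_assoc, div_mul_cancel₀ _ hc0]
    exact LinearMap.congr_fun this x
  all_goals simp [hA, hAs, hE, hEs]

/-- `T` is antidiagonal on the split basis `{τ^*_i(A^*) v}` with `v ∈ E_d V`. -/
theorem IsSelfDual.T_splitVector_Down_dual {Φ : LeonardSystem F V d} (h : Φ.IsSelfDual) {v : V}
    (hv : v ∈ LinearMap.range (Φ.E (Fin.last d))) (hv0 : v ≠ 0) {j : ℕ} (hj : j ≤ d) :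
    Φ.T (Φ.Down.dual.splitVector v j) =
      (Φ.splitScalar * ∏ k ∈ Finset.range j, extendZero Φ.secondSplit k) •
        Φ.Down.dual.splitVector v (d - j) := by
  have hth := h.thstar_eq_th
  obtain ⟨S, hST, -, hAs, hE, -⟩ := h.exists_T_eq
  have hv' : v ∈ LinearMap.range (Φ.Down.dual.Estar 0) := by simpa [Down, dual] using hv
  have hch := Φ.Down.dual.isSplitChain hv' hv0
  have hlower : ∀ i ≤ d, aeval Φ.A (nodal (extend Φ.th) i) (Φ.Down.dual.splitVector v d) =
      (∏ k ∈ Finset.range i, extendZero Φ.secondSplit k) • Φ.Down.dual.splitVector v (d - i) := by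
    intro i hi
    have h2 : nodal (extend Φ.th) i = nodal (fun k => extend Φ.Down.dual.thstar (d - k)) i := by
      refine nodal_congr fun k hk => ?_
      change _ = extend Φ.Down.th (d - k)
      rw [extend_th_Down, show d - (d - k) = k by omega]
    have h3 : ∏ k ∈ Finset.range i, extendZero Φ.secondSplit k =
        ∏ k ∈ Finset.range i, extendZero Φ.Down.dual.firstSplit (d - 1 - k) := by
      rw [← h.prod_secondSplit_rev hi]
      refine Finset.prod_congr rfl fun k hk => ?_
      have := Finset.mem_range.1 hk
      exact (Φ.Down.extendZero_firstSplit_dual (by omega)).symm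
    rw [h2, h3]
    exact hch.aeval_nodal_rev hi
  -- τ_d(A) sends the last split vector to a nonzero multiple of v, and E_d τ_d(A) = τ_d(θ_d) E_d.
  -- Hence E_d is injective on the line E^*_d V, and `hTv` can compare factors after applying E_d.
  have hlast : Φ.E (Fin.last d) (Φ.Down.dual.splitVector v d) ≠ 0 := by
    intro h0
    have h1 := congrArg (Φ.E (Fin.last d)) (hlower d le_rfl)
    rw [apply_aeval_of_smul _ Φ.idem_last_apply_A, h0, smul_zero, map_smul, Nat.sub_self,
      splitVector_zero, Φ.th_spec.idem_apply_of_mem_range hv] at h1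
    exact smul_ne_zero (Finset.prod_ne_zero_iff.2 fun k hk =>
      Φ.secondSplit_ne_zero (Finset.mem_range.1 hk)) hv0 h1.symm
  have hu : Φ.Down.dual.splitVector v d ≠ 0 := fun h0 => hlast (by rw [h0, map_zero])
  have hTv : Φ.T v = Φ.splitScalar • Φ.Down.dual.splitVector v d := by
    have h1 : Φ.T v ∈ LinearMap.range (Φ.Estar (Fin.last d)) :=
      ⟨Φ.T v, by rw [← hST, ← hE, Φ.th_spec.idem_apply_of_mem_range hv]⟩
    obtain ⟨c, hc⟩ := Φ.thstar_spec.exists_smul _ (Φ.Down.dual.splitVector_last_mem v) hu h1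
    have h2 : Φ.E (Fin.last d) (Φ.T v) =
        Φ.splitScalar • Φ.E (Fin.last d) (Φ.Down.dual.splitVector v d) :=
      Φ.idem_last_T_apply hth v
    rw [← hc, map_smul] at h2
    rw [← hc, smul_left_injective F hlast h2]
  have h1 : S (Φ.Down.dual.splitVector v j) = aeval Φ.A (nodal (extend Φ.thstar) j) (S v) :=
    apply_aeval S.toLinearMap hAs _ v
  rw [← hST, h1, hST, hTv, map_smul, hth, hlower j hj, smul_smul]

/-! ### From the action on basis vectors to matrices, and the four bases. -/

/-- The matrix of `T` in a basis on which `T` is antidiagonal with the right coefficients. -/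
theorem toMatrix_T_eq (Φ : LeonardSystem F V d) (b : Module.Basis (Fin (d + 1)) F V)
    (h : ∀ i, Φ.T (b i) =
      (Φ.splitScalar * ∏ k ∈ Finset.range i.val, extendZero Φ.secondSplit k) • b i.rev) :
    LinearMap.toMatrix b b Φ.T = Φ.antidiagonalMatrix := by
  ext r i
  rw [LinearMap.toMatrix_apply, h, antidiagonalMatrix, ← splitScalar, Matrix.smul_apply,
    Matrix.of_apply, prod_extendZero _ (by omega : i.val ≤ d), map_smul, Finsupp.smul_apply,
    Module.Basis.repr_self, Finsupp.single_apply]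
  by_cases hr : r = i.rev
  · simp [hr]
  · simp [hr, Ne.symm hr]

/-- A basis on which `T` is antidiagonal is carried by `T` to another one. -/
theorem exists_basis_smul_T (Φ : LeonardSystem F V d) (b : Module.Basis (Fin (d + 1)) F V)
    (h : ∀ i, Φ.T (b i) =
      (Φ.splitScalar * ∏ k ∈ Finset.range i.val, extendZero Φ.secondSplit k) • b i.rev)
    {S : V ≃ₗ[F] V} (hS : ∀ x, S x = Φ.T x) {c : F} (hc : c ≠ 0) :
    ∃ b' : Module.Basis (Fin (d + 1)) F V, (∀ i, b' i = c • Φ.T (b i)) ∧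
      LinearMap.toMatrix b' b' Φ.T = Φ.antidiagonalMatrix := by
  have hb : ∀ i, b.map (S.trans (LinearEquiv.smulOfNeZero F V c hc)) i = c • Φ.T (b i) := by
    intro i
    simp [← hS]
  refine ⟨_, hb, Φ.toMatrix_T_eq _ fun i => ?_⟩
  rw [hb, hb, map_smul, h, map_smul, smul_comm]

end LeonardSystem

theorem theorem14p3 {F V : Type*} [Field F] [AddCommGroup V] [Module F V] {d : ℕ}
    (Φ : LeonardSystem F V d) (hΦ : Φ.IsSelfDual)
    (v₀ v_d vstar₀ vstar_d : V)
    (hv₀ : v₀ ∈ LinearMap.range (Φ.E 0)) (hv₀' : v₀ ≠ 0)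
    (hv_d : v_d ∈ LinearMap.range (Φ.E (Fin.last d))) (hv_d' : v_d ≠ 0)
    (hvstar₀ : vstar₀ ∈ LinearMap.range (Φ.Estar 0)) (hvstar₀' : vstar₀ ≠ 0)
    (hvstar_d : vstar_d ∈ LinearMap.range (Φ.Estar (Fin.last d))) (hvstar_d' : vstar_d ≠ 0) :
    (∃ b : Module.Basis (Fin (d + 1)) F V,
      (∀ i, b i = Polynomial.aeval Φ.Astar (Leonard.eta Φ.thstar i) v₀) ∧
        LinearMap.toMatrix b b Φ.T = Φ.antidiagonalMatrix) ∧
    (∃ b : Module.Basis (Fin (d + 1)) F V,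
      (∀ i, b i = Polynomial.aeval Φ.A (Leonard.eta Φ.th i) vstar₀) ∧
        LinearMap.toMatrix b b Φ.T = Φ.antidiagonalMatrix) ∧
    (∃ b : Module.Basis (Fin (d + 1)) F V,
      (∀ i, b i = Polynomial.aeval Φ.Astar (Leonard.tau Φ.thstar i) v_d) ∧
        LinearMap.toMatrix b b Φ.T = Φ.antidiagonalMatrix) ∧
    (∃ b : Module.Basis (Fin (d + 1)) F V,
      (∀ i, b i = Polynomial.aeval Φ.A (Leonard.tau Φ.th i) vstar_d) ∧
        LinearMap.toMatrix b b Φ.T = Φ.antidiagonalMatrix) := by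
  have hth := hΦ.thstar_eq_th
  obtain ⟨S, hST, hA, hAs, hE, hEs⟩ := hΦ.exists_T_eq
  have hvstar₀D : vstar₀ ∈ LinearMap.range (Φ.Down.Estar 0) := hvstar₀
  have hb₁ : ∀ i, Φ.Down.splitBasis vstar₀ hvstar₀D hvstar₀' i =
      Polynomial.aeval Φ.A (Leonard.eta Φ.th i) vstar₀ := fun i => by
    rw [LeonardSystem.splitBasis_apply, Leonard.eta_eq_tau, ← LeonardSystem.th_Down,
      Leonard.tau_eq_nodal]
    rfl
  have hT₁ : ∀ i, Φ.T (Φ.Down.splitBasis vstar₀ hvstar₀D hvstar₀' i) =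
      (Φ.splitScalar * ∏ k ∈ Finset.range i.val, Leonard.extendZero Φ.secondSplit k) •
        Φ.Down.splitBasis vstar₀ hvstar₀D hvstar₀' i.rev := fun i => by
    rw [LeonardSystem.splitBasis_apply, LeonardSystem.splitBasis_apply,
      Φ.T_splitVector_Down hth hvstar₀ hvstar₀' (by omega), Fin.val_rev, Nat.add_sub_add_right]
  have hv_dd : v_d ∈ LinearMap.range (Φ.Down.dual.Estar 0) := by
    simpa [LeonardSystem.Down, LeonardSystem.dual] using hv_d
  have hb₂ : ∀ i, Φ.Down.dual.splitBasis v_d hv_dd hv_d' i =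
      Polynomial.aeval Φ.Astar (Leonard.tau Φ.thstar i) v_d := fun i => by
    rw [LeonardSystem.splitBasis_apply, Leonard.tau_eq_nodal]
    rfl
  have hT₂ : ∀ i, Φ.T (Φ.Down.dual.splitBasis v_d hv_dd hv_d' i) =
      (Φ.splitScalar * ∏ k ∈ Finset.range i.val, Leonard.extendZero Φ.secondSplit k) •
        Φ.Down.dual.splitBasis v_d hv_dd hv_d' i.rev := fun i => by
    rw [LeonardSystem.splitBasis_apply, LeonardSystem.splitBasis_apply,
      hΦ.T_splitVector_Down_dual hv_d hv_d' (by omega), Fin.val_rev, Nat.add_sub_add_right]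
  refine ⟨?_, ⟨_, hb₁, Φ.toMatrix_T_eq _ hT₁⟩, ⟨_, hb₂, Φ.toMatrix_T_eq _ hT₂⟩, ?_⟩
  -- T carries the line E^*_0 V onto E_0 V and turns η_i(A) into η_i(A^*), so this basis is a
  -- multiple of the image of the one built on `vstar₀`.
  · have h1 : S vstar₀ ∈ LinearMap.range (Φ.E 0) :=
      ⟨S vstar₀, by rw [← hEs, Φ.thstar_spec.idem_apply_of_mem_range hvstar₀]⟩
    obtain ⟨c, rfl⟩ := Φ.th_spec.exists_smul 0 h1 (S.map_ne_zero_iff.2 hvstar₀') hv₀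
    obtain ⟨b, hb, hM⟩ := Φ.exists_basis_smul_T _ hT₁ hST (left_ne_zero_of_smul hv₀')
    refine ⟨b, fun i => ?_, hM⟩
    rw [hb, hb₁, ← hST, hth, map_smul]
    exact congrArg (c • ·) (Leonard.apply_aeval S.toLinearMap hA _ _)
  · have h1 : S v_d ∈ LinearMap.range (Φ.Estar (Fin.last d)) :=
      ⟨S v_d, by rw [← hE, Φ.th_spec.idem_apply_of_mem_range hv_d]⟩
    obtain ⟨c, rfl⟩ := Φ.thstar_spec.exists_smul _ h1 (S.map_ne_zero_iff.2 hv_d') hvstar_d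
    obtain ⟨b, hb, hM⟩ := Φ.exists_basis_smul_T _ hT₂ hST (left_ne_zero_of_smul hvstar_d')
    refine ⟨b, fun i => ?_, hM⟩
    rw [hb, hb₂, ← hST, hth, map_smul]
    exact congrArg (c • ·) (Leonard.apply_aeval S.toLinearMap hAs _ _)
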